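/- Let $G$ be a locally compact Polish group, let $(X,\mathcal B,m)$ be a standard Borel space with a $\sigma$-finite measure, and let $T$ be an ergodic non-singular action of $G$ on $(X,\mathcal B,m)$. Suppose that $L_\infty(X,\mathcal B,m)$ (real or complex valued) has a finite-dimensional linear subspace $V$ that is $G$-invariant, i.e. $f\circ T_g\in V$ for all $f\in V$ and $g\in G$, and non-trivial, i.e. $V$ contains a function that is not almost everywhere equal to a constant. Then $T$ is not weakly mixing: there are a standard probability space $(Y,\mathcal C,\nu)$ and an ergodic probability preserving action $S$ of $G$ on it such that the product action $g\mapsto T_g\times S_g$ on $(X\times Y,\,m\times\nu)$ is not ergodic. Here a non-singular action is a continuous homomorphism $g\mapsto T_g$ from $G$ to the group of invertible bi-measurable transformations of $(X,\mathcal B,m)$ that preserve the class of null sets, where transformations that agree almost everywhere are identified. This group carries the weak operator topology of the Koopman operators $U_{T}f=\sqrt{d(m\circ T)/dm}\cdot f\circ T$ on $L_2(X,\mathcal B,m)$. The action is probability preserving if $m$ is a probability measure and every $T_g$ preserves $m$. It is ergodic if every $A\in\mathcal B$ with $m(T_gA\,\triangle\,A)=0$ for all $g\in G$ satisfies $m(A)=0$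 or $m(X\setminus A)=0$. -/

import Mathlib

open MeasureTheory
open scoped ENNReal

/-- The Koopman operator `U_g f = √(d(m ∘ T_g)/dm) · (f ∘ T_g)` of a family of transformations `T`
indexed by a group. Here `m ∘ T_g` is the measure `A ↦ m (T_g A)`, that is, the push-forward of `m`
under the inverse transformation `T_{g⁻¹}`. -/
noncomputable def koopman {G X : Type*} [Group G] [MeasurableSpace X]
    (T : G → X → X) (m : Measure X) (g : G) (f : X → ℝ) : X → ℝ :=
  fun x => √(((m.map (T g⁻¹)).rnDeriv m x).toReal) * f (T g x)

/-- `T` is a non-singular action of the topological group `G` on `(X, m)`: a continuous homomorphism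
from `G` to the group of invertible non-singular transformations of `(X, m)`. Transformations are
identified when they agree almost everywhere, so `T g` is a measurable representative and the group
laws hold almost everywhere for each fixed pair of group elements (this gives the invertibility).
The topology of the group of non-singular transformations is the weak operator topology of
the associated Koopman operators on `L²(X, m)`. -/
structure IsNonsingularAction {G X : Type*} [Group G] [TopologicalSpace G] [MeasurableSpace X]
    (T : G → X → X) (m : Measure X) : Prop where
  measurable : ∀ g, Measurable (T g)
  nonsingular : ∀ g, ∀ C, MeasurableSet C → (m C = 0 ↔ m (T g ⁻¹' C) = 0)
  map_one : ∀ᵐ x ∂m, T 1 x = x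
  map_mul : ∀ g h, ∀ᵐ x ∂m, T (g * h) x = T g (T h x)
  continuous : ∀ f₁ f₂ : X → ℝ, MemLp f₁ 2 m → MemLp f₂ 2 m →
    Continuous fun g => ∫ x, koopman T m g f₁ x * f₂ x ∂m

/-- `T` is a measure preserving action of `G` on `(X, m)`. -/
structure IsMeasurePreservingAction {G X : Type*} [Group G] [TopologicalSpace G]
    [MeasurableSpace X] (T : G → X → X) (m : Measure X) : Prop extends
    IsNonsingularAction T m where
  measurePreserving : ∀ g, MeasurePreserving (T g) m m

/-- Ergodicity: a measurable set that is invariant modulo null sets under all `T g` is null or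
conull. For an action, invariance under all preimages `T g ⁻¹' A` is the same as
invariance under all images `T g '' A`, since `T g A = T g⁻¹ ⁻¹' A` modulo null sets. -/
def IsErgodicAction {G X : Type*} [MeasurableSpace X] (T : G → X → X) (m : Measure X) : Prop :=
  ∀ A, MeasurableSet A → (∀ g, T g ⁻¹' A =ᵐ[m] A) → m A = 0 ∨ m Aᶜ = 0

/-- Weak mixing: the product with every ergodic probability preserving action of `G` on a standard
probability space is ergodic. Every standard Borel space is Borel isomorphic to
a Borel subset of `ℝ`, so it is no restriction to let `Y` range over `Type`. -/
def IsWeaklyMixingAction {G X : Type*} [Group G] [TopologicalSpace G] [MeasurableSpace X]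
    (T : G → X → X) (m : Measure X) : Prop :=
  ∀ (Y : Type) [MeasurableSpace Y] [StandardBorelSpace Y] (ν : Measure Y) [IsProbabilityMeasure ν]
    (S : G → Y → Y), IsMeasurePreservingAction S ν → IsErgodicAction S ν →
    IsErgodicAction (fun g => Prod.map (T g) (S g)) (m.prod ν)

/-- A subspace `V` of `L^∞(X, m)` is invariant: `f ∘ T g ∈ V` for all `f ∈ V` and all `g`. -/
def IsInvariantSubspace {G X 𝕜 : Type*} [RCLike 𝕜] [MeasurableSpace X]
    (T : G → X → X) (m : Measure X) (V : Submodule 𝕜 (Lp 𝕜 ∞ m)) : Prop :=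
  ∀ g, ∀ f ∈ V, ∃ h ∈ V, (h : X → 𝕜) =ᵐ[m] (f : X → 𝕜) ∘ T g

/-- A subspace of `L^∞(X, m)` is non-trivial if it contains a function that is not almost everywhere
equal to a constant (the constant functions always form an invariant subspace). -/
def IsNontrivialSubspace {X 𝕜 : Type*} [RCLike 𝕜] [MeasurableSpace X]
    {m : Measure X} (V : Submodule 𝕜 (Lp 𝕜 ∞ m)) : Prop :=
  ∃ f ∈ V, ¬ ∃ c : 𝕜, (f : X → 𝕜) =ᵐ[m] fun _ => c

/-! A basis `φ` of the invariant space, taken over the reals, satisfies `φ (T g x) = A g φ(x)` for a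
matrix representation `A` of `G`. It is bounded because composition does not increase the essential
supremum, and continuous because the action is weakly continuous (`exists_matrix_representation`).
Hence the closure `K` of its image is a compact group (`isCompact_topologicalClosure_range`), on
which `G` acts ergodically by left translation, preserving Haar measure. The function `F (x, k) =
k⁻¹ φ(x)` is invariant under the product action. If that action were ergodic, `F` would be constant
almost everywhere. Fixing a suitable `k` would make `φ`, and so every function in the space, almost
everywhere constant. -/

open Filter Topology

/-! ### Koopman operators and continuity of translation -/

section Koopman

variable {G X : Type*} [Group G] [TopologicalSpace G] [MeasurableSpace X] {m : Measure X}
  {T : G → X → X}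

theorem IsNonsingularAction.quasiMeasurePreserving (hT : IsNonsingularAction T m) (g : G) :
    Measure.QuasiMeasurePreserving (T g) m m :=
  ⟨hT.measurable g, Measure.AbsolutelyContinuous.mk fun s hs h => by
    rw [Measure.map_apply (hT.measurable g) hs]; exact (hT.nonsingular g s hs).1 h⟩

theorem IsNonsingularAction.ae_inv_right (hT : IsNonsingularAction T m) (g : G) :
    ∀ᵐ x ∂m, T g (T g⁻¹ x) = x := by
  filter_upwards [hT.map_mul g g⁻¹, hT.map_one] with x h1 h2
  rw [← h1, mul_inv_cancel, h2]

theorem measurable_koopman (hT : IsNonsingularAction T m) (g : G) {f : X → ℝ}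
    (hf : Measurable f) : Measurable (koopman T m g f) :=
  (Measure.measurable_rnDeriv _ _).ennreal_toReal.sqrt.mul (hf.comp (hT.measurable g))

omit [TopologicalSpace G] in
theorem koopman_mul (g : G) (u f : X → ℝ) (x : X) :
    koopman T m g (fun y => u y * f y) x = u (T g x) * koopman T m g f x := by
  simp only [koopman]; ring

omit [TopologicalSpace G] in
theorem koopman_ae_eq_comp [SigmaFinite m] {g : G} (h : m.map (T g⁻¹) = m) (f : X → ℝ) :
    koopman T m g f =ᵐ[m] f ∘ T g := by
  have h1 := Measure.rnDeriv_self m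
  filter_upwards [h1] with x hx
  simp [koopman, h, hx]

theorem koopman_one_ae_eq [SigmaFinite m] (hT : IsNonsingularAction T m) (f : X → ℝ) :
    koopman T m (1 : G) f =ᵐ[m] f := by
  have h : m.map (T (1 : G)⁻¹) = m := by
    have h' : T (1 : G)⁻¹ =ᵐ[m] id := by
      filter_upwards [hT.map_one] with x hx
      simpa using hx
    rw [Measure.map_congr h', Measure.map_id]
  filter_upwards [koopman_ae_eq_comp h f, hT.map_one] with x hx h1
  rw [hx, Function.comp_apply, h1]

/-- Change of variables. The bound `withDensity (rnDeriv) ≤ m.map (T g⁻¹)` suffices, so equality of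
these measures is not needed. -/
theorem lintegral_koopman_sq_le (hT : IsNonsingularAction T m) (g : G) {f : X → ℝ}
    (hf : Measurable f) :
    ∫⁻ x, ENNReal.ofReal (koopman T m g f x ^ 2) ∂m ≤ ∫⁻ x, ENNReal.ofReal (f x ^ 2) ∂m := by
  set ρ := (m.map (T g⁻¹)).rnDeriv m with hρ
  have hF : Measurable fun x => ENNReal.ofReal (f x ^ 2) := (hf.pow_const 2).ennreal_ofReal
  calc ∫⁻ x, ENNReal.ofReal (koopman T m g f x ^ 2) ∂m
      ≤ ∫⁻ x, (ρ * fun x => ENNReal.ofReal (f (T g x) ^ 2)) x ∂m := by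
        refine lintegral_mono fun x => ?_
        simp only [koopman, mul_pow, Pi.mul_apply]
        rw [Real.sq_sqrt ENNReal.toReal_nonneg, ENNReal.ofReal_mul ENNReal.toReal_nonneg]
        gcongr
        exact ENNReal.ofReal_toReal_le
    _ = ∫⁻ x, ENNReal.ofReal (f (T g x) ^ 2) ∂(m.withDensity ρ) :=
        (lintegral_withDensity_eq_lintegral_mul _ (Measure.measurable_rnDeriv _ _)
          (hF.comp (hT.measurable g))).symm
    _ ≤ ∫⁻ x, ENNReal.ofReal (f (T g x) ^ 2) ∂(m.map (T g⁻¹)) :=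
        lintegral_mono' (Measure.withDensity_rnDeriv_le _ _) le_rfl
    _ = ∫⁻ x, ENNReal.ofReal (f (T g (T g⁻¹ x)) ^ 2) ∂m :=
        lintegral_map (hF.comp (hT.measurable g)) (hT.measurable _)
    _ = ∫⁻ x, ENNReal.ofReal (f x ^ 2) ∂m := by
        refine lintegral_congr_ae ?_
        filter_upwards [hT.ae_inv_right g] with x hx
        rw [hx]

theorem memLp_koopman (hT : IsNonsingularAction T m) (g : G) {f : X → ℝ}
    (hf : Measurable f) (hf2 : MemLp f 2 m) : MemLp (koopman T m g f) 2 m := by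
  have hk := measurable_koopman hT g hf
  rw [memLp_two_iff_integrable_sq hk.aestronglyMeasurable]
  rw [memLp_two_iff_integrable_sq hf.aestronglyMeasurable] at hf2
  refine ⟨(hk.pow_const 2).aestronglyMeasurable, ?_⟩
  rw [hasFiniteIntegral_iff_ofReal (ae_of_all _ fun x => sq_nonneg _)]
  refine (lintegral_koopman_sq_le hT g hf).trans_lt ?_
  rw [← hasFiniteIntegral_iff_ofReal (ae_of_all _ fun x => sq_nonneg _)]
  exact hf2.2

theorem integral_koopman_sq_le (hT : IsNonsingularAction T m) (g : G) {f : X → ℝ}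
    (hf : Measurable f) (hf2 : MemLp f 2 m) :
    ∫ x, koopman T m g f x ^ 2 ∂m ≤ ∫ x, f x ^ 2 ∂m := by
  rw [integral_eq_lintegral_of_nonneg_ae (ae_of_all _ fun x => sq_nonneg _)
      ((measurable_koopman hT g hf).pow_const 2).aestronglyMeasurable,
    integral_eq_lintegral_of_nonneg_ae (ae_of_all _ fun x => sq_nonneg _)
      (hf.pow_const 2).aestronglyMeasurable]
  refine ENNReal.toReal_mono ?_ (lintegral_koopman_sq_le hT g hf)
  have := ((memLp_two_iff_integrable_sq hf.aestronglyMeasurable).1 hf2).2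
  rw [hasFiniteIntegral_iff_ofReal (ae_of_all _ fun x => sq_nonneg _)] at this
  exact this.ne

/-- Cauchy–Schwarz: the quadratic `t ↦ ∫ (|f| - t)²` is nonnegative, so its discriminant is not
positive. -/
theorem sq_integral_abs_le {μ : Measure X} [IsFiniteMeasure μ] {f : X → ℝ} (hf : MemLp f 2 μ) :
    (∫ x, |f x| ∂μ) ^ 2 ≤ μ.real Set.univ * ∫ x, f x ^ 2 ∂μ := by
  have hi : Integrable (fun x => |f x|) μ := (hf.integrable one_le_two).abs
  have hs : Integrable (fun x => f x ^ 2) μ := hf.integrable_sq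
  have key : ∀ t : ℝ, 0 ≤ μ.real Set.univ * (t * t) + (-2 * ∫ x, |f x| ∂μ) * t
      + ∫ x, f x ^ 2 ∂μ := by
    intro t
    have h0 : 0 ≤ ∫ x, (f x ^ 2 - 2 * t * |f x| + t * t) ∂μ := by
      refine integral_nonneg fun x => ?_
      have := sq_nonneg (|f x| - t)
      have h2 := sq_abs (f x)
      simp only [Pi.zero_apply]
      nlinarith
    have h1 := integral_add (hs.sub (hi.const_mul (2 * t))) (integrable_const (μ := μ) (t * t))
    have h2 := integral_sub hs (hi.const_mul (2 * t))
    simp only [Pi.sub_apply] at h1 h2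
    rw [h1, h2, integral_const_mul, integral_const, smul_eq_mul] at h0
    linarith
  have := discrim_le_zero key
  rw [discrim] at this
  nlinarith

theorem memLp_indicator_one {B : Set X} (hB : MeasurableSet B) (hBm : m B < ∞) :
    MemLp (B.indicator fun _ => (1 : ℝ)) 2 m :=
  memLp_indicator_const 2 hB 1 (Or.inr hBm.ne)

theorem setIntegral_eq_integral_mul_indicator {B : Set X} (hB : MeasurableSet B) (f : X → ℝ) :
    ∫ x in B, f x ∂m = ∫ x, f x * B.indicator (fun _ => (1 : ℝ)) x ∂m := by
  rw [← integral_indicator hB]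
  congr 1 with x
  by_cases h : x ∈ B <;> simp [h]

/-- Weak continuity of contractions gives strong continuity: with `e = 1_B`, `∫_B (U_g e - 1)² ≤ 2
m(B) - 2 ∫_B U_g e`, which tends to `0`. -/
theorem tendsto_setIntegral_abs_koopman_sub_one [SigmaFinite m] (hT : IsNonsingularAction T m)
    {B : Set X} (hB : MeasurableSet B) (hBm : m B < ∞) :
    Tendsto (fun g => ∫ x in B, |koopman T m g (B.indicator fun _ => 1) x - 1| ∂m)
      (𝓝 1) (𝓝 0) := by
  set e : X → ℝ := B.indicator fun _ => 1 with he
  have heM : Measurable e := measurable_const.indicator hB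
  have heL : MemLp e 2 m := memLp_indicator_one hB hBm
  have : IsFiniteMeasure (m.restrict B) := ⟨by simpa using hBm⟩
  have hee : ∫ x, e x ^ 2 ∂m = m.real B := by
    have : (fun x => e x ^ 2) = B.indicator fun _ => 1 := by
      ext x; by_cases h : x ∈ B <;> simp [he, h]
    rw [this, integral_indicator hB]; simp
  have hc : Tendsto (fun g => ∫ x in B, koopman T m g e x ∂m) (𝓝 1) (𝓝 (m.real B)) := by
    have h : Tendsto (fun g => ∫ x in B, koopman T m g e x ∂m) (𝓝 1)
        (𝓝 (∫ x in B, koopman T m 1 e x ∂m)) := by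
      simpa only [setIntegral_eq_integral_mul_indicator hB] using
        (hT.continuous e e heL heL).tendsto 1
    convert h using 2
    rw [setIntegral_congr_ae (g := e) hB
      ((koopman_one_ae_eq hT _).mono fun x hx _ => hx), setIntegral_eq_integral_mul_indicator hB,
      ← hee]
    simp_rw [sq]
    rfl
  have hbound : ∀ g, (∫ x in B, |koopman T m g e x - 1| ∂m) ≤
      √(m.real B * (2 * m.real B - 2 * ∫ x in B, koopman T m g e x ∂m)) := by
    intro g
    refine Real.le_sqrt_of_sq_le ?_
    have hk : MemLp (koopman T m g e) 2 (m.restrict B) := (memLp_koopman hT g heM heL).restrict B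
    refine (sq_integral_abs_le (hk.sub (memLp_const 1))).trans ?_
    rw [measureReal_restrict_apply_univ]
    refine mul_le_mul_of_nonneg_left ?_ measureReal_nonneg
    have hi := hk.integrable one_le_two
    have hs := hk.integrable_sq
    have h1 : ∫ x in B, (koopman T m g e x - 1) ^ 2 ∂m
        = ∫ x in B, (koopman T m g e x ^ 2 - 2 * koopman T m g e x + 1) ∂m := by
      congr 1 with x; ring
    have h2 : ∫ x in B, koopman T m g e x ^ 2 ∂m ≤ m.real B := by
      rw [← hee]
      exact (setIntegral_le_integral (memLp_koopman hT g heM heL).integrable_sq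
        (ae_of_all _ fun x => sq_nonneg _)).trans (integral_koopman_sq_le hT g heM heL)
    have h3 := integral_add (hs.sub (hi.const_mul 2)) (integrable_const (μ := m.restrict B) (1 : ℝ))
    have h4 := integral_sub hs (hi.const_mul 2)
    simp only [Pi.sub_apply] at h3 h4 ⊢
    rw [h1, h3, h4, integral_const_mul]
    simp
    linarith
  refine squeeze_zero (fun g => integral_nonneg fun x => abs_nonneg _) hbound ?_
  have : Tendsto (fun g => √(m.real B * (2 * m.real B - 2 * ∫ x in B, koopman T m g e x ∂m)))
      (𝓝 1) (𝓝 (√(m.real B * (2 * m.real B - 2 * m.real B)))) :=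
    ((tendsto_const_nhds.sub (hc.const_mul 2)).const_mul _).sqrt
  simpa using this

/-- Bounded functions depend weakly continuously on translation by the action. -/
theorem tendsto_setIntegral_comp [SigmaFinite m] (hT : IsNonsingularAction T m)
    {B : Set X} (hB : MeasurableSet B) (hBm : m B < ∞) {u : X → ℝ} (hu : Measurable u) {C : ℝ}
    (hC : ∀ᵐ x ∂m, |u x| ≤ C) :
    Tendsto (fun g => ∫ x in B, u (T g x) ∂m) (𝓝 1) (𝓝 (∫ x in B, u x ∂m)) := by
  set e : X → ℝ := B.indicator fun _ => 1 with he
  have heM : Measurable e := measurable_const.indicator hB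
  have heL : MemLp e 2 m := memLp_indicator_one hB hBm
  have : IsFiniteMeasure (m.restrict B) := ⟨by simpa using hBm⟩
  have huL : MemLp u ∞ m := memLp_top_of_bound hu.aestronglyMeasurable C hC
  have hueL : MemLp (fun x => u x * e x) 2 m := by
    simpa [mul_comm] using! heL.mul huL
  -- Since `U_g (u e) = (u ∘ T g) U_g e`, weak continuity applies to `u e`. Replacing `U_g e` by `1`
  -- on `B` then costs an error tending to `0`.
  have h1 : Tendsto (fun g => ∫ x in B, u (T g x) * koopman T m g e x ∂m) (𝓝 1)
      (𝓝 (∫ x in B, u x ∂m)) := by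
    have h : Tendsto (fun g => ∫ x in B, u (T g x) * koopman T m g e x ∂m) (𝓝 1)
        (𝓝 (∫ x in B, u (T 1 x) * koopman T m 1 e x ∂m)) := by
      simpa only [setIntegral_eq_integral_mul_indicator hB, koopman_mul] using
        (hT.continuous _ e hueL heL).tendsto 1
    convert h using 2
    refine setIntegral_congr_ae hB ?_
    filter_upwards [koopman_one_ae_eq hT e, hT.map_one] with x hx hx1 hxB
    rw [hx, hx1]; simp [he, hxB]
  have h2 : Tendsto (fun g => ∫ x in B, u (T g x) * (koopman T m g e x - 1) ∂m) (𝓝 1) (𝓝 0) := by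
    have h3 := (tendsto_setIntegral_abs_koopman_sub_one hT hB hBm).const_mul C
    rw [mul_zero] at h3
    refine squeeze_zero_norm (fun g => ?_) h3
    have hk : MemLp (koopman T m g e) 2 (m.restrict B) := (memLp_koopman hT g heM heL).restrict B
    rw [← integral_const_mul]
    refine norm_integral_le_of_norm_le
      (((hk.integrable one_le_two).sub (integrable_const 1)).abs.const_mul C) ?_
    refine ae_restrict_of_ae ?_
    filter_upwards [(hT.quasiMeasurePreserving g).ae hC] with x hx
    rw [norm_mul, Real.norm_eq_abs, Real.norm_eq_abs]
    exact mul_le_mul_of_nonneg_right hx (abs_nonneg _)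
  have h3 := h1.sub h2
  rw [sub_zero] at h3
  refine h3.congr fun g => ?_
  have hk : MemLp (koopman T m g e) 2 (m.restrict B) := (memLp_koopman hT g heM heL).restrict B
  have hki := hk.integrable one_le_two
  have hb : ∀ᵐ x ∂(m.restrict B), ‖u (T g x)‖ ≤ C :=
    ae_restrict_of_ae ((hT.quasiMeasurePreserving g).ae hC)
  have hum : AEStronglyMeasurable (fun x => u (T g x)) (m.restrict B) :=
    (hu.comp (hT.measurable g)).aestronglyMeasurable
  have h4 := integral_sub (hki.bdd_mul hum hb) ((hki.sub (integrable_const 1)).bdd_mul hum hb)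
  simp only [Pi.sub_apply] at h4
  rw [← h4]
  congr 1 with x
  ring

end Koopman

/-! ### Translations of a compact group -/

section CompactGroup

/-- Translations of a compact group by a dense subgroup are an ergodic measure preserving
action. -/
theorem isMeasurePreservingAction_mul_left {G K : Type*} [Group G] [TopologicalSpace G]
    [Group K] [TopologicalSpace K] [IsTopologicalGroup K] [CompactSpace K] [T2Space K]
    [SecondCountableTopology K] [MeasurableSpace K] [BorelSpace K] (ν : Measure K)
    [IsProbabilityMeasure ν] [ν.IsHaarMeasure] (a : G →* K) (ha : Continuous a) :
    IsMeasurePreservingAction (fun g k => a g * k) ν where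
  measurable g := measurable_const_mul _
  nonsingular g C hC := by rw [measure_preimage_mul]
  map_one := by simp
  map_mul g h := by simp [mul_assoc]
  measurePreserving g := measurePreserving_mul_left ν _
  continuous f₁ f₂ h₁ h₂ := by
    -- Matrix coefficients of the translation action on `L²`, which is strongly continuous.
    have hp : ∀ g, ∫ x, koopman (fun g k => a g * k) ν g f₁ x * f₂ x ∂ν =
        inner ℝ (DomMulAct.mk (a g) • h₁.toLp f₁) (h₂.toLp f₂) := by
      intro g
      rw [L2.inner_def]
      refine integral_congr_ae ?_
      have h3 := koopman_ae_eq_comp (T := fun g k => a g * k) (m := ν) (g := g)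
        (measurePreserving_mul_left ν _).map_eq f₁
      have h4 := (measurePreserving_mul_left ν (a g)).quasiMeasurePreserving.ae h₁.coeFn_toLp
      filter_upwards [h3, h4, h₂.coeFn_toLp,
        DomMulAct.smul_Lp_ae_eq (DomMulAct.mk (a g)) (h₁.toLp f₁)] with x hx1 hx2 hx3 hx4
      rw [hx1, hx3, hx4]
      simp [hx2, mul_comm]
    simp_rw [hp]
    have hmk : Continuous fun g => DomMulAct.mk (a g) := DomMulAct.continuous_mk.comp ha
    have : Fact ((2 : ℝ≥0∞) ≠ ∞) := ⟨ENNReal.ofNat_ne_top⟩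
    exact (hmk.smul continuous_const).inner continuous_const

theorem isErgodicAction_mul_left {G K : Type*}
    [Group K] [TopologicalSpace K] [IsTopologicalGroup K] [CompactSpace K] [T2Space K]
    [SecondCountableTopology K] [MeasurableSpace K] [BorelSpace K] (ν : Measure K)
    [IsProbabilityMeasure ν] [ν.IsHaarMeasure] (a : G → K) (ha : DenseRange a) :
    IsErgodicAction (fun g k => a g * k) ν := by
  intro A hA hinv
  have h := aeconst_of_dense_setOfPred_preimage_smul_ae (M := K) (μ := ν) hA.nullMeasurableSet
    (ha.mono (Set.range_subset_iff.2 fun g => hinv g))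
  rcases eventuallyConst_set'.1 h with h | h
  · exact Or.inl (ae_eq_empty.1 h)
  · exact Or.inr (ae_eq_univ.1 h)

end CompactGroup

/-! ### The matrix representation on an invariant space -/

section Representation

variable {X 𝕜 : Type*} [RCLike 𝕜] [MeasurableSpace X] {m : Measure X}

theorem norm_le_of_ae_eq_comp {f h : Lp 𝕜 ∞ m} {S : X → X}
    (hS : Measure.QuasiMeasurePreserving S m m) (hfh : (h : X → 𝕜) =ᵐ[m] (f : X → 𝕜) ∘ S) :
    ‖h‖ ≤ ‖f‖ := by
  rw [Lp.norm_def, Lp.norm_def]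
  refine ENNReal.toReal_mono (Lp.memLp f).2.ne ?_
  rw [eLpNorm_congr_ae hfh, eLpNorm_exponent_top, eLpNorm_exponent_top]
  exact eLpNormEssSup_le_of_ae_enorm_bound (hS.ae (ae_le_eLpNormEssSup (f := (f : X → 𝕜))))

theorem ae_norm_le_norm_Lp_top (f : Lp 𝕜 ∞ m) : ∀ᵐ x ∂m, ‖(f : X → 𝕜) x‖ ≤ ‖f‖ := by
  have h := ae_le_eLpNormEssSup (f := (f : X → 𝕜)) (μ := m)
  filter_upwards [h] with x hx
  rw [Lp.norm_def, eLpNorm_exponent_top, ← toReal_enorm]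
  refine ENNReal.toReal_mono ?_ hx
  rw [← eLpNorm_exponent_top]
  exact (Lp.memLp f).2.ne

theorem integrableOn_clm_Lp_top (R : 𝕜 →L[ℝ] ℝ) (f : Lp 𝕜 ∞ m) {B : Set X} (hBm : m B < ∞) :
    IntegrableOn (fun x => R ((f : X → 𝕜) x)) B m := by
  have : IsFiniteMeasure (m.restrict B) := ⟨by simpa using hBm⟩
  exact R.integrable_comp (((Lp.memLp f).restrict B).integrable le_top)

/-- Integration of a real part of an essentially bounded function over a set of finite measure. -/
noncomputable def setIntegralFunctional (R : 𝕜 →L[ℝ] ℝ) (B : Set X) (hBm : m B < ∞) :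
    Lp 𝕜 ∞ m →ₗ[ℝ] ℝ where
  toFun f := ∫ x in B, R ((f : X → 𝕜) x) ∂m
  map_add' f g := by
    rw [← integral_add (integrableOn_clm_Lp_top R f hBm) (integrableOn_clm_Lp_top R g hBm)]
    refine integral_congr_ae (ae_restrict_of_ae ?_)
    filter_upwards [Lp.coeFn_add f g] with x hx
    rw [hx, Pi.add_apply, map_add]
  map_smul' c f := by
    rw [RingHom.id_apply, smul_eq_mul, ← integral_const_mul]
    refine integral_congr_ae (ae_restrict_of_ae ?_)
    filter_upwards [Lp.coeFn_smul c f] with x hx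
    simp [hx]

/-- These functionals separate points, so on a finite-dimensional subspace they span the dual. -/
theorem eq_zero_of_setIntegralFunctional_eq_zero [SigmaFinite m] (f : Lp 𝕜 ∞ m)
    (h : ∀ (R : 𝕜 →L[ℝ] ℝ) (B : Set X) (_ : MeasurableSet B) (hBm : m B < ∞),
      setIntegralFunctional R B hBm f = 0) : f = 0 := by
  have key : ∀ R : 𝕜 →L[ℝ] ℝ, (fun x => R ((f : X → 𝕜) x)) =ᵐ[m] 0 := fun R =>
    ae_eq_zero_of_forall_setIntegral_eq_of_sigmaFinite
      (fun s _ hsm => integrableOn_clm_Lp_top R f hsm) fun s hs hsm => h R s hs hsm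
  rw [Lp.eq_zero_iff_ae_eq_zero]
  filter_upwards [key RCLike.reCLM, key RCLike.imCLM] with x h1 h2
  exact RCLike.ext (by simpa using! h1) (by simpa using! h2)

theorem tendsto_setIntegralFunctional {G : Type*} [Group G] [TopologicalSpace G]
    [SigmaFinite m]
    {T : G → X → X} (hT : IsNonsingularAction T m)
    (R : 𝕜 →L[ℝ] ℝ) {B : Set X} (hB : MeasurableSet B) (hBm : m B < ∞) (f : Lp 𝕜 ∞ m)
    (P : G → Lp 𝕜 ∞ m) (hP : ∀ g, (P g : X → 𝕜) =ᵐ[m] (f : X → 𝕜) ∘ T g) :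
    Tendsto (fun g => setIntegralFunctional R B hBm (P g)) (𝓝 1)
      (𝓝 (setIntegralFunctional R B hBm f)) := by
  have h := tendsto_setIntegral_comp hT hB hBm (u := fun x => R ((f : X → 𝕜) x)) (C := ‖R‖ * ‖f‖)
    (R.continuous.measurable.comp (Lp.stronglyMeasurable f).measurable) (by
      filter_upwards [ae_norm_le_norm_Lp_top f] with x hx
      exact (R.le_opNorm _).trans (by gcongr))
  refine h.congr fun g => integral_congr_ae (ae_restrict_of_ae ?_)
  filter_upwards [hP g] with x hx
  simp [hx]

theorem coeFn_sum_smul {ι : Type*} [Fintype ι] (c : ι → ℝ) (f : ι → Lp 𝕜 ∞ m) :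
    ((∑ i, c i • f i : Lp 𝕜 ∞ m) : X → 𝕜) =ᵐ[m] fun x => ∑ i, c i • (f i : X → 𝕜) x := by
  filter_upwards [Lp.coeFn_finsetSum Finset.univ fun i => c i • f i,
    ae_all_iff.2 fun i => Lp.coeFn_smul (c i) (f i)] with x h1 h2
  rw [h1, Finset.sum_apply]
  exact Finset.sum_congr rfl fun i _ => h2 i

theorem coeFn_ae_eq_sum_repr {W : Submodule ℝ (Lp 𝕜 ∞ m)} {ι : Type*} [Fintype ι]
    (b : Module.Basis ι ℝ W) (v : W) : ((v : Lp 𝕜 ∞ m) : X → 𝕜) =ᵐ[m]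
      fun x => ∑ j, b.repr v j • ((b j : Lp 𝕜 ∞ m) : X → 𝕜) x := by
  have h := coeFn_sum_smul (b.repr v) fun j => (b j : Lp 𝕜 ∞ m)
  have hv : (v : Lp 𝕜 ∞ m) = ∑ j, b.repr v j • (b j : Lp 𝕜 ∞ m) :=
    (congrArg W.subtype (b.sum_repr v).symm).trans (by rw [map_sum]; rfl)
  rwa [← hv] at h

/-- A finite-dimensional invariant space of essentially bounded functions defines a bounded
continuous matrix representation which describes the action on a basis. -/
theorem exists_matrix_representation {G : Type*} [Group G] [TopologicalSpace G]
    [IsTopologicalGroup G] [SigmaFinite m]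
    {T : G → X → X} (hT : IsNonsingularAction T m)
    (W : Submodule ℝ (Lp 𝕜 ∞ m)) [FiniteDimensional ℝ W]
    (hinv : ∀ g, ∀ f ∈ W, ∃ h ∈ W, (h : X → 𝕜) =ᵐ[m] (f : X → 𝕜) ∘ T g)
    {ι : Type*} [Fintype ι] [DecidableEq ι] (b : Module.Basis ι ℝ W) :
    ∃ A : G →* Matrix ι ι ℝ, Continuous A ∧ (∃ C, ∀ g i j, |A g i j| ≤ C) ∧
      ∀ g i, ∀ᵐ x ∂m, ((b i : Lp 𝕜 ∞ m) : X → 𝕜) (T g x) =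
        ∑ j, A g i j • ((b j : Lp 𝕜 ∞ m) : X → 𝕜) x := by
  have hinv' : ∀ g (f : W), ∃ h : W, ((h : Lp 𝕜 ∞ m) : X → 𝕜) =ᵐ[m] (f : Lp 𝕜 ∞ m) ∘ T g := by
    intro g f
    obtain ⟨h, hW, hh⟩ := hinv g f f.2
    exact ⟨⟨h, hW⟩, hh⟩
  choose P hP using hinv'
  have huniq : ∀ (v : W) (c : ι → ℝ), ((v : Lp 𝕜 ∞ m) : X → 𝕜) =ᵐ[m]
      (fun x => ∑ j, c j • ((b j : Lp 𝕜 ∞ m) : X → 𝕜) x) → ∀ j, b.repr v j = c j := by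
    intro v c h j
    have hv : v = ∑ j, c j • b j := by
      apply Subtype.ext
      apply Lp.ext
      refine h.trans ((coeFn_sum_smul c fun j => (b j : Lp 𝕜 ∞ m)).symm.trans ?_)
      simp
    rw [hv, b.repr_sum_self]
  let A : G → Matrix ι ι ℝ := fun g i j => b.repr (P g (b i)) j
  have hA : ∀ g i, ∀ᵐ x ∂m, ((b i : Lp 𝕜 ∞ m) : X → 𝕜) (T g x) =
        ∑ j, A g i j • ((b j : Lp 𝕜 ∞ m) : X → 𝕜) x := by
    intro g i
    filter_upwards [hP g (b i), coeFn_ae_eq_sum_repr b (P g (b i))] with x h1 h2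
    rw [← h2, h1, Function.comp_apply]
  have hone : A 1 = 1 := by
    ext i j
    refine huniq _ (fun j => (1 : Matrix ι ι ℝ) i j) ?_ j
    filter_upwards [hP 1 (b i), hT.map_one] with x h1 h2
    simp [h1, h2, Matrix.one_apply, ite_smul]
  have hmul : ∀ g h, A (g * h) = A g * A h := by
    intro g h
    ext i j
    refine huniq _ (fun j => (A g * A h) i j) ?_ j
    -- Non-singularity of `T h` allows the relation for `g` to be used at `T h x`.
    filter_upwards [hP (g * h) (b i), hT.map_mul g h, (hT.quasiMeasurePreserving h).ae (hA g i),
      ae_all_iff.2 fun k => hA h k] with x h1 h2 h3 h4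
    rw [h1, Function.comp_apply, h2, h3]
    simp_rw [h4, Matrix.mul_apply, Finset.sum_smul, Finset.smul_sum, smul_smul]
    exact Finset.sum_comm
  refine ⟨⟨⟨A, hone⟩, hmul⟩, ?_, ?_, hA⟩
  · refine continuous_of_continuousAt_one (⟨⟨A, hone⟩, hmul⟩ : G →* Matrix ι ι ℝ) ?_
    -- Functionals along which the orbits of basis vectors are continuous at `1`. This subspace
    -- contains the separating integrals, hence is the whole dual and includes the coordinates.
    let Φ : Submodule ℝ (Module.Dual ℝ W) :=
      { carrier := {l | ∀ i, Tendsto (fun g => l (P g (b i))) (𝓝 1) (𝓝 (l (b i)))}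
        add_mem' := fun h1 h2 i => (h1 i).add (h2 i)
        zero_mem' := fun i => tendsto_const_nhds
        smul_mem' := fun c l h i => (h i).const_mul c }
    have hΦ : Φ = ⊤ := by
      rw [← Subspace.dualCoannihilator_dualAnnihilator_eq (W := Φ), Submodule.eq_top_iff']
      intro l
      rw [Submodule.mem_dualAnnihilator]
      intro w hw
      rw [Submodule.mem_dualCoannihilator] at hw
      have : w = 0 := by
        apply Subtype.ext
        refine eq_zero_of_setIntegralFunctional_eq_zero _ fun R B hB hBm => ?_
        exact hw ((setIntegralFunctional R B hBm).comp W.subtype) fun i =>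
          tendsto_setIntegralFunctional hT R hB hBm (b i) (fun g => P g (b i)) fun g => hP g (b i)
      rw [this, map_zero]
    change Tendsto A (𝓝 1) (𝓝 (A 1))
    rw [hone]
    refine tendsto_pi_nhds.2 fun i => tendsto_pi_nhds.2 fun j => ?_
    have hmem : b.coord j ∈ Φ := hΦ ▸ Submodule.mem_top
    have h := hmem i
    simpa [Matrix.one_apply, Finsupp.single_apply] using! h
  · refine ⟨∑ i, ∑ j, ‖LinearMap.toContinuousLinearMap (b.coord j)‖ * ‖b i‖, fun g i j => ?_⟩
    have h1 : |A g i j| ≤ ‖LinearMap.toContinuousLinearMap (b.coord j)‖ * ‖b i‖ := by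
      refine ((LinearMap.toContinuousLinearMap (b.coord j)).le_opNorm (P g (b i))).trans ?_
      gcongr
      exact norm_le_of_ae_eq_comp (hT.quasiMeasurePreserving g) (hP g (b i))
    refine h1.trans ((Finset.single_le_sum
      (f := fun j => ‖LinearMap.toContinuousLinearMap (b.coord j)‖ * ‖b i‖)
      (fun _ _ => by positivity) (Finset.mem_univ j)).trans ?_)
    exact Finset.single_le_sum
      (f := fun i => ∑ j, ‖LinearMap.toContinuousLinearMap (b.coord j)‖ * ‖b i‖)
      (fun _ _ => Finset.sum_nonneg fun _ _ => by positivity) (Finset.mem_univ i)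

end Representation

/-! ### Compactness of the closure of a bounded matrix group -/

section Compactness

/-- A group of real matrices with bounded entries has compact closure. -/
theorem isCompact_topologicalClosure_range {G ι : Type*} [Group G] [Fintype ι] [DecidableEq ι]
    (A : G →* Matrix ι ι ℝ) {C : ℝ} (hC : ∀ g i j, |A g i j| ≤ C) :
    IsCompact (A.toHomUnits.range.topologicalClosure : Set (Matrix ι ι ℝ)ˣ) := by
  let S : Set (Matrix ι ι ℝ) := {M | ∀ i j, M i j ∈ Set.Icc (-C) C}
  have hS : IsCompact S := by
    have h := isCompact_univ_pi fun _ : ι => isCompact_univ_pi fun _ : ι =>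
      (isCompact_Icc : IsCompact (Set.Icc (-C) C))
    convert! h using 1
    ext M
    exact ⟨fun h i _ j _ => h i j, fun h i j => h i trivial j trivial⟩
  -- The topology on units also records inverses; these obey the same bound because `(A g)⁻¹ = A
  -- g⁻¹`.
  have hc : IsCompact (Units.embedProduct (Matrix ι ι ℝ) ⁻¹' (S ×ˢ (MulOpposite.unop ⁻¹' S))) :=
    Units.isClosedEmbedding_embedProduct.isCompact_preimage
      (hS.prod (MulOpposite.opHomeomorph.symm.isClosedEmbedding.isCompact_preimage hS))
  refine hc.of_isClosed_subset (Subgroup.isClosed_topologicalClosure _)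
    (closure_minimal ?_ hc.isClosed)
  rintro _ ⟨g, rfl⟩
  have h : ∀ g, A g ∈ S := fun g i j => abs_le.1 (hC g i j)
  refine ⟨h g, ?_⟩
  change ((A.toHomUnits g)⁻¹ : (Matrix ι ι ℝ)ˣ).val ∈ S
  rw [← map_inv]
  exact h g⁻¹

theorem polishSpace_units_matrix (ι : Type*) [Fintype ι] [DecidableEq ι] :
    PolishSpace (Matrix ι ι ℝ)ˣ := by
  have h1 : PolishSpace (Matrix ι ι ℝ) := inferInstanceAs (PolishSpace (ι → ι → ℝ))
  have h2 : PolishSpace (Matrix ι ι ℝ)ᵐᵒᵖ :=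
    MulOpposite.opHomeomorph.symm.isClosedEmbedding.polishSpace
  exact Units.isClosedEmbedding_embedProduct.polishSpace

/-- The linear action of real matrices on vectors over a field containing the reals. -/
def realMulVec {ι 𝕜 : Type*} [Fintype ι] [AddCommGroup 𝕜] [Module ℝ 𝕜] (M : Matrix ι ι ℝ)
    (v : ι → 𝕜) : ι → 𝕜 :=
  fun i => ∑ j, M i j • v j

theorem realMulVec_realMulVec {ι 𝕜 : Type*} [Fintype ι] [AddCommGroup 𝕜] [Module ℝ 𝕜]
    (M N : Matrix ι ι ℝ) (v : ι → 𝕜) :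
    realMulVec M (realMulVec N v) = realMulVec (M * N) v := by
  ext i
  simp_rw [realMulVec, Matrix.mul_apply, Finset.sum_smul, Finset.smul_sum, smul_smul]
  exact Finset.sum_comm

theorem realMulVec_one {ι 𝕜 : Type*} [Fintype ι] [DecidableEq ι] [AddCommGroup 𝕜] [Module ℝ 𝕜]
    (v : ι → 𝕜) : realMulVec (1 : Matrix ι ι ℝ) v = v := by
  ext i
  simp [realMulVec, Matrix.one_apply, ite_smul]

end Compactness

/-! ### Invariant functions and the main theorem -/

theorem IsErgodicAction.ae_eq_const {G X Z : Type*} [MeasurableSpace X] {T : G → X → X}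
    {μ : Measure X} (h : IsErgodicAction T μ) [MeasurableSpace Z] [Nonempty Z]
    [MeasurableSpace.CountablySeparated Z] {F : X → Z} (hF : Measurable F)
    (hinv : ∀ g, F ∘ T g =ᵐ[μ] F) : ∃ c, F =ᵐ[μ] fun _ => c := by
  refine exists_eventuallyEq_const_of_forall_separating MeasurableSet fun U hU => ?_
  rcases h (F ⁻¹' U) (hF hU) fun g => (hinv g).preimage U with h0 | h1
  · exact Or.inr (by simpa [ae_iff] using! h0)
  · exact Or.inl (by simpa [ae_iff] using! h1)

theorem mainTheorem3 {G : Type*} [Group G] [TopologicalSpace G] [IsTopologicalGroup G]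
    [LocallyCompactSpace G] [PolishSpace G]
    {X : Type*} [MeasurableSpace X] [StandardBorelSpace X] (m : Measure X) [SigmaFinite m]
    (T : G → X → X) (hT : IsNonsingularAction T m) (hergodic : IsErgodicAction T m)
    {𝕜 : Type*} [RCLike 𝕜] (V : Submodule 𝕜 (Lp 𝕜 ∞ m)) (hfin : FiniteDimensional 𝕜 V)
    (hinv : IsInvariantSubspace T m V) (hnontriv : IsNontrivialSubspace V) :
    ¬ IsWeaklyMixingAction T m := by
  intro hwm
  let W : Submodule ℝ (Lp 𝕜 ∞ m) := V.restrictScalars ℝ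
  have hfinW : FiniteDimensional ℝ W := FiniteDimensional.trans ℝ 𝕜 V
  let d := Module.finrank ℝ W
  -- Indexing by `Fin d` places `K` in `Type`, as `IsWeaklyMixingAction` requires.
  let b : Module.Basis (Fin d) ℝ W := Module.finBasis ℝ W
  obtain ⟨A, hAc, ⟨C, hC⟩, hA⟩ := exists_matrix_representation hT W hinv b
  let M := Matrix (Fin d) (Fin d) ℝ
  let K : Subgroup Mˣ := A.toHomUnits.range.topologicalClosure
  have hKc : CompactSpace K := isCompact_iff_compactSpace.1 (isCompact_topologicalClosure_range A hC)
  have hKcl : IsClosed (K : Set Mˣ) := Subgroup.isClosed_topologicalClosure _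
  have hMp : PolishSpace Mˣ := polishSpace_units_matrix (Fin d)
  have hKp : PolishSpace K := hKcl.isClosedEmbedding_subtypeVal.polishSpace
  borelize ↥K
  let a : G →* K := A.toHomUnits.codRestrict K fun g => subset_closure ⟨g, rfl⟩
  have hau : Continuous A.toHomUnits := by
    refine Units.continuous_iff.2 ⟨hAc, ?_⟩
    simp_rw [← map_inv]
    exact hAc.comp continuous_inv
  have hac : Continuous a := hau.subtype_mk _
  have hadense : DenseRange a := by
    intro k
    rw [Topology.IsInducing.subtypeVal.closure_eq_preimage_closure_image, ← Set.range_comp]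
    exact k.2
  let ν : Measure K := Measure.haarMeasure ⊤
  have hν : IsProbabilityMeasure ν := ⟨Measure.haarMeasure_self⟩
  have herg := hwm K ν (fun g k => a g * k) (isMeasurePreservingAction_mul_left ν a hac)
    (isErgodicAction_mul_left ν a hadense)
  let φ : X → Fin d → 𝕜 := fun x i => ((b i : Lp 𝕜 ∞ m) : X → 𝕜) x
  have hφ : Measurable φ := measurable_pi_iff.2 fun i => (Lp.stronglyMeasurable _).measurable
  have hφT : ∀ g, ∀ᵐ x ∂m, φ (T g x) = realMulVec (A g) (φ x) := fun g =>
    (ae_all_iff.2 (hA g)).mono fun x hx => funext hx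
  -- Invariant because `(a g k)⁻¹ A g = k⁻¹`.
  let F : X × K → Fin d → 𝕜 := fun p => realMulVec (p.2⁻¹ : K).1.1 (φ p.1)
  have hF : Measurable F := by
    refine measurable_pi_iff.2 fun i => Finset.measurable_sum _ fun j _ => Measurable.smul ?_ ?_
    · have hcont : Continuous fun k : K => (k⁻¹ : K).1.1 i j :=
        (Units.continuous_val.comp (continuous_subtype_val.comp continuous_inv)).matrix_elem i j
      exact hcont.measurable.comp measurable_snd
    · exact (measurable_pi_apply j).comp (hφ.comp measurable_fst)
  have hFinv : ∀ g, F ∘ Prod.map (T g) (fun k => a g * k) =ᵐ[m.prod ν] F := by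
    intro g
    filter_upwards [Measure.quasiMeasurePreserving_fst.ae (hφT g)] with p hp
    change realMulVec ((a g * p.2)⁻¹ : K).1.1 (φ (T g p.1)) = realMulVec (p.2⁻¹ : K).1.1 (φ p.1)
    rw [hp, realMulVec_realMulVec]
    congr 1
    change (((a g * p.2)⁻¹ * a g : K) : Mˣ).1 = _
    rw [mul_inv_rev, inv_mul_cancel_right]
  obtain ⟨c, hc⟩ := herg.ae_eq_const hF hFinv
  -- By Fubini, some single `k` satisfies `k⁻¹ φ(x) = c` for almost every `x`, so `φ = k c`.
  have hc' : ∀ᵐ k ∂ν, ∀ᵐ x ∂m, F (x, k) = c :=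
    (Measure.ae_ae_comm (p := fun x k => F (x, k) = c) (hF (measurableSet_singleton c))).1
      (Measure.ae_ae_of_ae_prod hc)
  obtain ⟨k, hk⟩ := hc'.exists
  have hconst : ∀ᵐ x ∂m, φ x = realMulVec k.1.1 c := by
    filter_upwards [hk] with x hx
    rw [← hx, realMulVec_realMulVec]
    change φ x = realMulVec ((k * k⁻¹ : K) : Mˣ).1 (φ x)
    rw [mul_inv_cancel]
    exact (realMulVec_one _).symm
  obtain ⟨f, hfV, hf⟩ := hnontriv
  refine hf ⟨∑ j, b.repr ⟨f, hfV⟩ j • realMulVec k.1.1 c j, ?_⟩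
  filter_upwards [coeFn_ae_eq_sum_repr b ⟨f, hfV⟩, hconst] with x h1 h2
  rw [← h2]
  exact h1
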